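/- Let $d \in \mathbb{N}$. For $h:\mathbb{R}^d\to\mathbb{R}\cup\{\infty\}$ write $\operatorname{dom} h=\{x : h(x)<\infty\}$, and let $h^*(x^*)=\sup\{\langle x,x^*\rangle-h(x) : x\in\operatorname{dom} h\}$ be its convex conjugate. A proper, closed (lower semicontinuous), convex function $h$ is called Legendre convex if 1. $\operatorname{int}(\operatorname{dom} h)\neq\emptyset$; 2. $h$ is differentiable on $\operatorname{int}(\operatorname{dom} h)$, and $\|\nabla h(x_i)\|\to\infty$ whenever $(x_i)$ is a sequence in $\operatorname{int}(\operatorname{dom} h)$ converging to a boundary point of $\operatorname{int}(\operatorname{dom} h)$; 3. $h$ is strictly convex on $\operatorname{int}(\operatorname{dom} h)$. For a proper closed convex function $h$ and $x,y\in\operatorname{dom} h$ let $D_h(x,y)=h(x)-h(y)-h'(y;x-y)$ be the (generalized) Bregman divergence, where $h'(y;v)=\lim_{\epsilon\downarrow 0}\frac{h(y+\epsilon v)-h(y)}{\epsilon}$; if $h$ is differentiable at $y\in\operatorname{int}(\operatorname{dom} h)$, then $D_h(x,y)=h(x)-h(y)-\langle\nabla h(y),x-y\rangle$. For proper closed convex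 functions $h,g$, a convex set $Q$, and $L,\mu\ge 0$, say that $h$ is $L$-smooth relative to $g$ on $Q$ if $Q\subseteq\operatorname{dom} h\cap\operatorname{dom} g$ and the function equal to $Lg-h$ on $Q$ and to $\infty$ outside $Q$ is convex, and that $h$ is $\mu$-strongly convex relative to $g$ on $Q$ if $Q\subseteq\operatorname{dom} h\cap\operatorname{dom} g$ and the function equal to $h-\mu g$ on $Q$ and to $\infty$ outside $Q$ is convex. **Proposition.** Let $f,k:\mathbb{R}^d\to\mathbb{R}\cup\{\infty\}$ be Legendre convex functions and let $L^*,\mu^*\ge 0$. The following are equivalent: 1. $k$ is $L^*$-smooth relative to $f^*$ on $\operatorname{int}(\operatorname{dom} f^*)$. 2. $\nabla f(\operatorname{int}(\operatorname{dom} f))\subseteq\operatorname{int}(\operatorname{dom} k)$, and $D_k(\nabla f(y),\nabla f(x))\le L^* D_f(x,y)$ for all $x,y\in\operatorname{int}(\operatorname{dom} f)$. The following are also equivalent: 3. $k$ is $\mu^*$-strongly convex relative to $f^*$ on $\operatorname{int}(\operatorname{dom} f^*)$. 4. $\nabla f(\operatorname{int}(\operatorname{dom} f))\subseteq\operatorname{int}(\operatorname{dom}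 k)$, and $\mu^* D_f(x,y)\le D_k(\nabla f(y),\nabla f(x))$ for all $x,y\in\operatorname{int}(\operatorname{dom} f)$. -/

import Mathlib

open Filter Topology

namespace DualPrecond

noncomputable section

/-- The effective domain of an extended-real-valued function. -/
def dom {d : ℕ} (h : EuclideanSpace ℝ (Fin d) → EReal) : Set (EuclideanSpace ℝ (Fin d)) :=
  {x | h x < ⊤}

/-- An extended-real-valued function is convex if its epigraph is a convex subset of `ℝᵈ × ℝ`. -/
def ConvexFun {d : ℕ} (h : EuclideanSpace ℝ (Fin d) → EReal) : Prop :=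
  Convex ℝ {p : EuclideanSpace ℝ (Fin d) × ℝ | h p.1 ≤ (p.2 : EReal)}

/-- A proper closed convex function `h : ℝᵈ → ℝ ∪ {∞}`. For proper convex functions, closedness
is lower semicontinuity. -/
structure IsProperClosedConvex {d : ℕ} (h : EuclideanSpace ℝ (Fin d) → EReal) : Prop where
  ne_bot : ∀ x, h x ≠ ⊥
  dom_nonempty : (dom h).Nonempty
  closed : LowerSemicontinuous h
  convex : ConvexFun h

/-- The real-valued function that agrees with `h` at every point where `h` is finite. It is only
used at (or near) points where `h` is finite. -/
def finPart {d : ℕ} (h : EuclideanSpace ℝ (Fin d) → EReal) : EuclideanSpace ℝ (Fin d) → ℝ :=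
  fun x => (h x).toReal

/-- The gradient of `h`, at points of the interior of its domain where `h` is differentiable. -/
def grad {d : ℕ} (h : EuclideanSpace ℝ (Fin d) → EReal) (x : EuclideanSpace ℝ (Fin d)) :
    EuclideanSpace ℝ (Fin d) :=
  gradient (finPart h) x

/-- Essentially smooth (proper closed convex) functions. -/
structure IsEssentiallySmooth {d : ℕ} (h : EuclideanSpace ℝ (Fin d) → EReal) : Prop
    extends IsProperClosedConvex h where
  interior_nonempty : (interior (dom h)).Nonempty
  differentiable : ∀ x ∈ interior (dom h), DifferentiableAt ℝ (finPart h) x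
  norm_grad_tendsto : ∀ (u : ℕ → EuclideanSpace ℝ (Fin d)), (∀ i, u i ∈ interior (dom h)) →
    ∀ x ∈ frontier (interior (dom h)), Tendsto u atTop (𝓝 x) →
      Tendsto (fun i => ‖grad h (u i)‖) atTop atTop

/-- Legendre convex functions. -/
structure IsLegendre {d : ℕ} (h : EuclideanSpace ℝ (Fin d) → EReal) : Prop
    extends IsEssentiallySmooth h where
  strictConvex : StrictConvexOn ℝ (interior (dom h)) (finPart h)

/-- The convex conjugate `h*(x*) = sup {⟨x, x*⟩ - h(x) : x ∈ dom h}`. -/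
def conjugate {d : ℕ} (h : EuclideanSpace ℝ (Fin d) → EReal) :
    EuclideanSpace ℝ (Fin d) → EReal :=
  fun xs => ⨆ x ∈ dom h, ((inner ℝ x xs : ℝ) : EReal) - h x

/-- The one-sided directional derivative `h'(x; y) = lim_{ε ↓ 0} (h(x + ε y) - h(x)) / ε`, with
values in `[-∞, ∞]`. The limit exists for every convex `h` and every `x` where `h` is finite. -/
def dirDeriv {d : ℕ} (h : EuclideanSpace ℝ (Fin d) → EReal)
    (x y : EuclideanSpace ℝ (Fin d)) : EReal :=
  limUnder (𝓝[>] (0 : ℝ)) fun ε : ℝ => (h (x + ε • y) - h x) / (ε : EReal)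

/-- The (generalized) Bregman divergence `D_h(x, y) = h(x) - h(y) - h'(y; x - y)`, for `x`, `y`
at which `h` is finite. -/
def bregman {d : ℕ} (h : EuclideanSpace ℝ (Fin d) → EReal)
    (x y : EuclideanSpace ℝ (Fin d)) : EReal :=
  h x - h y - dirDeriv h y (x - y)

open Classical in
/-- `L g - h` on `Q`, extended by `∞` outside `Q`. -/
def smoothGap {d : ℕ} (h g : EuclideanSpace ℝ (Fin d) → EReal)
    (Q : Set (EuclideanSpace ℝ (Fin d))) (L : ℝ) : EuclideanSpace ℝ (Fin d) → EReal :=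
  fun x => if x ∈ Q then (L : EReal) * g x - h x else ⊤

open Classical in
/-- `h - μ g` on `Q`, extended by `∞` outside `Q`. -/
def strongGap {d : ℕ} (h g : EuclideanSpace ℝ (Fin d) → EReal)
    (Q : Set (EuclideanSpace ℝ (Fin d))) (μ : ℝ) : EuclideanSpace ℝ (Fin d) → EReal :=
  fun x => if x ∈ Q then h x - (μ : EReal) * g x else ⊤

/-- `h` is `L`-smooth relative to `g` on the convex set `Q ⊆ dom h ∩ dom g`. -/
def RelSmoothOn {d : ℕ} (h g : EuclideanSpace ℝ (Fin d) → EReal)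
    (Q : Set (EuclideanSpace ℝ (Fin d))) (L : ℝ) : Prop :=
  Convex ℝ Q ∧ Q ⊆ dom h ∩ dom g ∧ ConvexFun (smoothGap h g Q L)

/-- `h` is `μ`-strongly convex relative to `g` on the convex set `Q ⊆ dom h ∩ dom g`. -/
def RelStronglyConvexOn {d : ℕ} (h g : EuclideanSpace ℝ (Fin d) → EReal)
    (Q : Set (EuclideanSpace ℝ (Fin d))) (μ : ℝ) : Prop :=
  Convex ℝ Q ∧ Q ⊆ dom h ∩ dom g ∧ ConvexFun (strongGap h g Q μ)

end

end DualPrecond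

/-!
The gradient of a Legendre function `f` maps `U = int (dom f)` onto `V = int (dom f*)`, and `f*` is
differentiable on `V` with `∇f* (∇f x) = x`. Once this is known, Fenchel-Young equality gives
`D_{f*}(∇f y, ∇f x) = D_f(x, y)`, and both equivalences say that `L f* - k`, respectively
`k - μ f*`, is convex on `V` exactly when it lies above its tangent planes there. The inclusion
`∇f(U) ⊆ int (dom k)` is the inclusion `V ⊆ dom k`, because `V` is open.

The description of `∇f` rests on three facts.

* `IsLegendre.exists_linear_growth`: by strict convexity and compactness of spheres, `f` minus its
  tangent plane at `x` grows at least linearly away from `x`. Hence `f*` is finite near `∇f x`, and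
  maximizers of `⟪·, q⟫ - f` converge to `x` as `q` tends to `∇f x`, which makes `f*` differentiable
  at `∇f x` with gradient `x`.
* `exists_norm_le_of_mem_interior_dom_conjugate`: for `p ∈ V` the sublevel sets of `f - ⟪p, ·⟫` are
  bounded, so this function attains its minimum, by lower semicontinuity.
* `IsEssentiallySmooth.mem_interior_of_isMinOn`: the minimum is attained in `U`, so that `p` is the
  gradient of `f` at the minimizer. At a boundary minimizer, the gradients along a segment towards
  an interior point would stay bounded, against essential smoothness.
-/

namespace DualPrecond

open Set

variable {d : ℕ}

local notation "𝔼" => EuclideanSpace ℝ (Fin d)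

/-! ### Convexity and gradients of real functions -/

theorem _root_.HasGradientAt.tendsto_slope {F : 𝔼 → ℝ} {g x : 𝔼} (h : HasGradientAt F g x)
    (v : 𝔼) :
    Tendsto (fun t : ℝ => (F (x + t • v) - F x) / t) (𝓝[>] 0) (𝓝 (inner ℝ g v)) := by
  have h1 := (h.hasFDerivAt.hasLineDerivAt v).tendsto_slope_zero_right
  simpa [div_eq_inv_mul] using h1

/-- A convex function lies above its tangent planes. -/
theorem _root_.ConvexOn.add_inner_le_of_hasGradientAt {F : 𝔼 → ℝ} {s : Set 𝔼}
    (hF : ConvexOn ℝ s F) {g x y : 𝔼} (hx : x ∈ s) (hy : y ∈ s) (h : HasGradientAt F g x) :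
    F x + inner ℝ g (y - x) ≤ F y := by
  have h1 : inner ℝ g (y - x) ≤ F y - F x := by
    refine le_of_tendsto (h.tendsto_slope (y - x)) ?_
    filter_upwards [Ioc_mem_nhdsGT (zero_lt_one' ℝ)] with t ht
    have h2 := hF.2 hx hy (sub_nonneg.2 ht.2) ht.1.le (by ring)
    have h3 : x + t • (y - x) = (1 - t) • x + t • y := by module
    rw [h3, div_le_iff₀ ht.1]
    simp only [smul_eq_mul] at h2
    linarith
  linarith

/-- A function on a convex set with a supporting hyperplane at every point is convex. -/
theorem convexOn_of_forall_add_inner_le {F : 𝔼 → ℝ} {s : Set 𝔼} (hs : Convex ℝ s) {g : 𝔼 → 𝔼}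
    (h : ∀ x ∈ s, ∀ y ∈ s, F x + inner ℝ (g x) (y - x) ≤ F y) : ConvexOn ℝ s F := by
  refine ⟨hs, fun x hx y hy a b ha hb hab => ?_⟩
  have hz := hs hx hy ha hb hab
  have hx' := mul_le_mul_of_nonneg_left (h _ hz x hx) ha
  have hy' := mul_le_mul_of_nonneg_left (h _ hz y hy) hb
  set z := a • x + b • y with hzdef
  have h0 : a * inner ℝ (g z) (x - z) + b * inner ℝ (g z) (y - z) = 0 := by
    rw [← real_inner_smul_right, ← real_inner_smul_right, ← inner_add_right]
    have : a • (x - z) + b • (y - z) = 0 := by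
      have : a • (x - z) + b • (y - z) = (a • x + b • y) - (a + b) • z := by module
      rw [this, hab, one_smul, ← hzdef, sub_self]
    rw [this, inner_zero_right]
  have h1 : F z = a * F z + b * F z := by rw [← add_mul, hab, one_mul]
  simp only [smul_eq_mul]
  linarith

theorem convexOn_iff_forall_add_inner_le {F : 𝔼 → ℝ} {s : Set 𝔼} (hs : Convex ℝ s) {g : 𝔼 → 𝔼}
    (hg : ∀ x ∈ s, HasGradientAt F (g x) x) :
    ConvexOn ℝ s F ↔ ∀ x ∈ s, ∀ y ∈ s, F x + inner ℝ (g x) (y - x) ≤ F y :=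
  ⟨fun hF x hx _ hy => hF.add_inner_le_of_hasGradientAt hx hy (hg x hx),
    convexOn_of_forall_add_inner_le hs⟩

/-! ### Real-valued versions of extended-real notions -/

theorem coe_finPart {h : 𝔼 → EReal} (hbot : ∀ x, h x ≠ ⊥) {x : 𝔼} (hx : x ∈ dom h) :
    (finPart h x : EReal) = h x :=
  EReal.coe_toReal (ne_of_lt hx) (hbot x)

theorem convexFun_iff_convexOn {h : 𝔼 → EReal} {s : Set 𝔼} {F : 𝔼 → ℝ}
    (hs : ∀ x ∈ s, h x = F x) (hs' : ∀ x ∉ s, h x = ⊤) : ConvexFun h ↔ ConvexOn ℝ s F := by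
  rw [convexOn_iff_convex_epigraph, ConvexFun]
  congr! 3 with p
  by_cases hp : p.1 ∈ s
  · simp [hp, hs _ hp]
  · simp [hp, hs' _ hp]

theorem IsProperClosedConvex.convexOn {h : 𝔼 → EReal} (hh : IsProperClosedConvex h) :
    ConvexOn ℝ (dom h) (finPart h) :=
  (convexFun_iff_convexOn (fun _ hx => (coe_finPart hh.ne_bot hx).symm)
    (fun x hx => by simpa [dom] using hx)).1 hh.convex

theorem IsEssentiallySmooth.hasGradientAt {h : 𝔼 → EReal} (hh : IsEssentiallySmooth h) {x : 𝔼}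
    (hx : x ∈ interior (dom h)) : HasGradientAt (finPart h) (grad h x) x :=
  (hh.differentiable x hx).hasGradientAt

theorem IsEssentiallySmooth.add_inner_grad_le {h : 𝔼 → EReal} (hh : IsEssentiallySmooth h)
    {x y : 𝔼} (hx : x ∈ interior (dom h)) (hy : y ∈ dom h) :
    finPart h x + inner ℝ (grad h x) (y - x) ≤ finPart h y :=
  hh.convexOn.add_inner_le_of_hasGradientAt (interior_subset hx) hy (hh.hasGradientAt hx)

/-- The Bregman divergence as a real number, computed with the gradient. -/
noncomputable def realBregman (h : 𝔼 → EReal) (x y : 𝔼) : ℝ :=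
  finPart h x - finPart h y - inner ℝ (grad h y) (x - y)

theorem IsEssentiallySmooth.dirDeriv_eq {h : 𝔼 → EReal} (hh : IsEssentiallySmooth h) {y : 𝔼}
    (hy : y ∈ interior (dom h)) (v : 𝔼) :
    dirDeriv h y v = ((inner ℝ (grad h y) v : ℝ) : EReal) := by
  refine Tendsto.limUnder_eq ?_
  refine ((continuous_coe_real_ereal.tendsto _).comp
    ((hh.hasGradientAt hy).tendsto_slope v)).congr' ?_
  have h1 : Tendsto (fun t : ℝ => y + t • v) (𝓝[>] 0) (𝓝 y) :=
    ((Continuous.tendsto' (by fun_prop) 0 _ (by simp))).mono_left nhdsWithin_le_nhds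
  filter_upwards [h1.eventually (isOpen_interior.mem_nhds hy)] with t ht
  simp only [Function.comp_apply]
  rw [EReal.coe_div, EReal.coe_sub, coe_finPart hh.ne_bot (interior_subset ht),
    coe_finPart hh.ne_bot (interior_subset hy)]

theorem IsEssentiallySmooth.bregman_eq {h : 𝔼 → EReal} (hh : IsEssentiallySmooth h) {x y : 𝔼}
    (hx : x ∈ dom h) (hy : y ∈ interior (dom h)) :
    bregman h x y = (realBregman h x y : EReal) := by
  rw [bregman, hh.dirDeriv_eq hy, realBregman, EReal.coe_sub, EReal.coe_sub,
    coe_finPart hh.ne_bot hx, coe_finPart hh.ne_bot (interior_subset hy)]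

/-! ### The conjugate -/

theorem conjugate_le_coe_iff {h : 𝔼 → EReal} (hbot : ∀ x, h x ≠ ⊥) {p : 𝔼} {c : ℝ} :
    conjugate h p ≤ c ↔ ∀ z ∈ dom h, inner ℝ z p - finPart h z ≤ c := by
  simp only [conjugate, iSup_le_iff]
  refine forall₂_congr fun z hz => ?_
  rw [← coe_finPart hbot hz, ← EReal.coe_sub, EReal.coe_le_coe_iff]

theorem mem_dom_conjugate_iff {h : 𝔼 → EReal} (hbot : ∀ x, h x ≠ ⊥) {p : 𝔼} :
    p ∈ dom (conjugate h) ↔ ∃ c : ℝ, ∀ z ∈ dom h, inner ℝ z p - finPart h z ≤ c := by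
  simp only [← conjugate_le_coe_iff hbot]
  refine ⟨fun hp => ⟨_, EReal.le_coe_toReal (ne_of_lt hp)⟩, fun ⟨c, hc⟩ => ?_⟩
  exact hc.trans_lt (EReal.coe_lt_top c)

theorem conjugate_ne_bot {h : 𝔼 → EReal} (hh : IsProperClosedConvex h) (p : 𝔼) :
    conjugate h p ≠ ⊥ := by
  obtain ⟨z, hz⟩ := hh.dom_nonempty
  intro hp
  have h1 : conjugate h p ≤ ((inner ℝ z p - finPart h z - 1 : ℝ) : EReal) := by rw [hp]; exact bot_le
  have := (conjugate_le_coe_iff hh.ne_bot).1 h1 z hz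
  linarith

/-- The Fenchel-Young inequality. -/
theorem inner_sub_finPart_le {h : 𝔼 → EReal} (hbot : ∀ x, h x ≠ ⊥) {p z : 𝔼}
    (hp : p ∈ dom (conjugate h)) (hz : z ∈ dom h) :
    inner ℝ z p - finPart h z ≤ finPart (conjugate h) p :=
  (conjugate_le_coe_iff hbot).1 (EReal.le_coe_toReal (ne_of_lt hp)) z hz

theorem convex_dom_conjugate {h : 𝔼 → EReal} (hbot : ∀ x, h x ≠ ⊥) :
    Convex ℝ (dom (conjugate h)) := by
  intro p hp q hq a b ha hb hab
  rw [mem_dom_conjugate_iff hbot] at *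
  obtain ⟨c, hc⟩ := hp
  obtain ⟨e, he⟩ := hq
  refine ⟨a * c + b * e, fun z hz => ?_⟩
  have h1 := mul_le_mul_of_nonneg_left (hc z hz) ha
  have h2 := mul_le_mul_of_nonneg_left (he z hz) hb
  have h3 : finPart h z = a * finPart h z + b * finPart h z := by rw [← add_mul, hab, one_mul]
  rw [inner_add_right, real_inner_smul_right, real_inner_smul_right]
  linarith

/-! ### The gradient of a Legendre function maps into the interior of the dual domain -/

/-- Strict convexity makes the Bregman divergence from an interior point grow at least linearly
away from that point. -/
theorem IsLegendre.exists_linear_growth {f : 𝔼 → EReal} (hf : IsLegendre f) {x : 𝔼}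
    (hx : x ∈ interior (dom f)) {r : ℝ} (hr : 0 < r) :
    ∃ η > 0, ∀ z ∈ dom f, r ≤ ‖z - x‖ →
      finPart f x + inner ℝ (grad f x) (z - x) + η * ‖z - x‖ ≤ finPart f z := by
  obtain ⟨r₀, hr₀, hball⟩ := Metric.nhds_basis_closedBall.mem_iff.1 (isOpen_interior.mem_nhds hx)
  set ρ := min r r₀
  have hρ : 0 < ρ := lt_min hr hr₀
  have hsph : Metric.sphere x ρ ⊆ interior (dom f) := fun z hz =>
    hball (Metric.closedBall_subset_closedBall (min_le_right _ _) (Metric.sphere_subset_closedBall hz))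
  set H : 𝔼 → ℝ := fun z => finPart f z - finPart f x - inner ℝ (grad f x) (z - x) with hH
  have hHconv : ∀ z ∈ dom f, ∀ t ∈ Icc (0 : ℝ) 1, H (x + t • (z - x)) ≤ t * H z := by
    intro z hz t ht
    have h2 := hf.convexOn.2 (interior_subset hx) hz (sub_nonneg.2 ht.2) ht.1 (by ring)
    have h3 : x + t • (z - x) = (1 - t) • x + t • z := by module
    simp only [hH, add_sub_cancel_left, real_inner_smul_right]
    rw [h3]
    simp only [smul_eq_mul] at h2
    linarith
  have hHpos : ∀ z ∈ interior (dom f), z ≠ x → 0 < H z := by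
    intro z hz hzx
    have h2 := hf.strictConvex.2 hx hz hzx.symm (half_pos one_pos) (half_pos one_pos)
      (add_halves (1 : ℝ))
    have hm := hf.strictConvex.1 hx hz (half_pos one_pos).le (half_pos one_pos).le
      (add_halves (1 : ℝ))
    have h3 := hf.add_inner_grad_le hx (interior_subset hm)
    have h4 : (1 / 2 : ℝ) • x + (1 / 2 : ℝ) • z - x = (1 / 2 : ℝ) • (z - x) := by module
    rw [h4, real_inner_smul_right] at h3
    simp only [smul_eq_mul] at h2
    simp only [hH]
    linarith
  by_cases hne : (Metric.sphere x ρ).Nonempty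
  · have hcont : ContinuousOn H (Metric.sphere x ρ) := by
      have : ContinuousOn (finPart f) (Metric.sphere x ρ) := fun z hz =>
        (hf.differentiable z (hsph hz)).continuousAt.continuousWithinAt
      fun_prop
    obtain ⟨w, hw, hmin⟩ := (isCompact_sphere x ρ).exists_isMinOn hne hcont
    have hwx : w ≠ x := by
      rintro rfl
      simp [hρ.ne] at hw
    have hδ := hHpos w (hsph hw) hwx
    refine ⟨H w / ρ, div_pos hδ hρ, fun z hz hzr => ?_⟩
    have hzρ : ρ ≤ ‖z - x‖ := (min_le_left _ _).trans hzr
    have hz0 : 0 < ‖z - x‖ := hρ.trans_le hzρ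
    have h1 := hHconv z hz (ρ / ‖z - x‖) ⟨by positivity, (div_le_one hz0).2 hzρ⟩
    have h2 : x + (ρ / ‖z - x‖) • (z - x) ∈ Metric.sphere x ρ := by
      simp [norm_smul, abs_of_pos hρ, hz0.ne']
    have h3 := (hmin h2 : H w ≤ _).trans h1
    have h4 : H w / ρ * ‖z - x‖ ≤ H z := by
      rw [div_mul_eq_mul_div, div_le_iff₀ hρ]
      rw [div_mul_eq_mul_div, le_div_iff₀ hz0] at h3
      linarith
    simp only [hH] at h4 ⊢
    linarith
  -- In dimension zero the sphere is empty and there is no point `z` to consider.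
  · refine ⟨1, one_pos, fun z hz hzr => (hne ?_).elim⟩
    have hz0 : 0 < ‖z - x‖ := hr.trans_le hzr
    exact ⟨x + (ρ / ‖z - x‖) • (z - x), by simp [norm_smul, abs_of_pos hρ, hz0.ne']⟩

theorem IsLegendre.grad_mem_interior_dom_conjugate {f : 𝔼 → EReal} (hf : IsLegendre f) {x : 𝔼}
    (hx : x ∈ interior (dom f)) : grad f x ∈ interior (dom (conjugate f)) := by
  obtain ⟨η, hη, hgrow⟩ := hf.exists_linear_growth hx one_pos
  refine mem_interior.2 ⟨Metric.ball (grad f x) η, fun q hq => ?_, Metric.isOpen_ball,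
    Metric.mem_ball_self hη⟩
  rw [mem_ball_iff_norm] at hq
  refine (mem_dom_conjugate_iff hf.ne_bot).2 ⟨inner ℝ x q - finPart f x + η, fun z hz => ?_⟩
  have h1 : inner ℝ z q - inner ℝ x q =
      inner ℝ (q - grad f x) (z - x) + inner ℝ (grad f x) (z - x) := by
    rw [← inner_add_left, sub_add_cancel, inner_sub_right, real_inner_comm, real_inner_comm x]
  have h2 : inner ℝ (q - grad f x) (z - x) ≤ η * ‖z - x‖ :=
    (real_inner_le_norm _ _).trans (mul_le_mul_of_nonneg_right hq.le (norm_nonneg _))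
  rcases le_total 1 ‖z - x‖ with h | h
  · have := hgrow z hz h
    linarith
  · have h3 := hf.add_inner_grad_le hx hz
    have h4 : η * ‖z - x‖ ≤ η * 1 := mul_le_mul_of_nonneg_left h hη.le
    linarith

/-! ### The gradient is onto the interior of the dual domain -/

/-- A linear perturbation of an essentially smooth function attains its minimum only at interior
points: near a boundary minimizer the gradients along a segment towards an interior point would
stay bounded. -/
theorem IsEssentiallySmooth.mem_interior_of_isMinOn {f : 𝔼 → EReal} (hf : IsEssentiallySmooth f)
    {x p : 𝔼} (hx : x ∈ dom f)
    (hmin : ∀ z ∈ dom f, finPart f x - inner ℝ p x ≤ finPart f z - inner ℝ p z) :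
    x ∈ interior (dom f) := by
  by_contra hxi
  obtain ⟨y, hy⟩ := hf.interior_nonempty
  have hfr : x ∈ frontier (interior (dom f)) := by
    rw [isOpen_interior.frontier_eq, hf.convexOn.1.closure_interior_eq_closure_of_nonempty_interior
      ⟨y, hy⟩]
    exact ⟨subset_closure hx, hxi⟩
  have hcy : ContinuousAt (finPart f) y := (hf.differentiable y hy).continuousAt
  have hev : ∀ᶠ z in 𝓝 y, z ∈ interior (dom f) ∧ finPart f z - inner ℝ p z
      ≤ finPart f y - inner ℝ p y + 1 := by
    refine (isOpen_interior.eventually_mem hy).and ?_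
    have hc : ContinuousAt (fun z => finPart f z - inner ℝ p z) y := by fun_prop
    exact hc.eventually (Iic_mem_nhds (lt_add_one _))
  obtain ⟨r, hr, hball⟩ := Metric.nhds_basis_closedBall.eventually_iff.1 hev
  set t : ℕ → ℝ := fun n => 1 / ((n : ℝ) + 1)
  have ht : ∀ n, t n ∈ Ioc (0 : ℝ) 1 := fun n =>
    ⟨Nat.one_div_pos_of_nat, by
      simp only [t]; rw [div_le_one (by positivity)]; linarith [(Nat.cast_nonneg n : (0 : ℝ) ≤ n)]⟩
  set u : ℕ → 𝔼 := fun n => x + t n • (y - x)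
  have hu : ∀ n, u n ∈ interior (dom f) := fun n =>
    hf.convexOn.1.add_smul_sub_mem_interior hx hy (ht n)
  have hux : Tendsto u atTop (𝓝 x) := by
    have h0 : Tendsto t atTop (𝓝 0) := tendsto_one_div_add_atTop_nhds_zero_nat
    simpa using tendsto_const_nhds.add (h0.smul_const (y - x))
  have hlim := hf.norm_grad_tendsto u hu x hfr hux
  set B := (finPart f y - inner ℝ p y + 1 - (finPart f x - inner ℝ p x)) / r + ‖p‖
  have hB : ∀ n, ‖grad f (u n)‖ ≤ B := by
    intro n
    -- `g` is the gradient at `u n` of the perturbed function `z ↦ f z - ⟪p, z⟫`.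
    set g := grad f (u n) - p with hg
    have hgr : ∀ z ∈ dom f, finPart f (u n) - inner ℝ p (u n) + inner ℝ g (z - u n)
        ≤ finPart f z - inner ℝ p z := by
      intro z hz
      have := hf.add_inner_grad_le (hu n) hz
      rw [hg, inner_sub_left, inner_sub_right p]
      linarith
    have h1 := hgr x hx
    have h2 := hmin (u n) (interior_subset (hu n))
    have h3 : inner ℝ g (x - u n) = - (t n * inner ℝ g (y - x)) := by
      rw [← real_inner_smul_right, ← inner_neg_right]; congr 1; simp [u]
    have h4 : 0 ≤ inner ℝ g (y - x) := by
      have : 0 ≤ t n * inner ℝ g (y - x) := by linarith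
      exact nonneg_of_mul_nonneg_right this (ht n).1
    set w := y + (r / ‖g‖) • g
    have hw : w ∈ Metric.closedBall y r := by
      rw [mem_closedBall_iff_norm]
      rcases eq_or_ne g 0 with h | h
      · simp [w, h, hr.le]
      · have := norm_ne_zero_iff.2 h
        simp [w, norm_smul, abs_of_pos hr, this]
    have h5 := hgr w (interior_subset (hball hw).1)
    have h6 := (hball hw).2
    have h7 : inner ℝ g (w - u n) = (1 - t n) * inner ℝ g (y - x) + r * ‖g‖ := by
      have : w - u n = (1 - t n) • (y - x) + (r / ‖g‖) • g := by simp only [w, u]; module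
      rw [this, inner_add_right, real_inner_smul_right, real_inner_smul_right,
        real_inner_self_eq_norm_sq]
      rcases eq_or_ne ‖g‖ 0 with h | h
      · simp [h]
      · field_simp
    have h8 : 0 ≤ (1 - t n) * inner ℝ g (y - x) := mul_nonneg (sub_nonneg.2 (ht n).2) h4
    have h9 : ‖g‖ ≤ (finPart f y - inner ℝ p y + 1 - (finPart f x - inner ℝ p x)) / r := by
      rw [le_div_iff₀ hr]
      linarith
    have h10 : ‖grad f (u n)‖ ≤ ‖g‖ + ‖p‖ := by
      simpa [hg] using norm_add_le g p
    linarith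
  obtain ⟨n, hn⟩ := (hlim.eventually_gt_atTop B).exists
  exact absurd (hB n) (not_le.2 hn)

/-- Coercivity: finiteness of the conjugate near `p` bounds the sublevel sets of `h - ⟪p, ·⟫`. -/
theorem exists_norm_le_of_mem_interior_dom_conjugate {h : 𝔼 → EReal} (hbot : ∀ x, h x ≠ ⊥)
    {p : 𝔼} (hp : p ∈ interior (dom (conjugate h))) (c : ℝ) :
    ∃ R, ∀ z ∈ dom h, finPart h z - inner ℝ p z ≤ c → ‖z‖ ≤ R := by
  obtain ⟨r, hr, hball⟩ := Metric.nhds_basis_closedBall.mem_iff.1 (mem_interior_iff_mem_nhds.1 hp)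
  have key : ∀ v : 𝔼, ‖v‖ = 1 → ∃ C, ∀ z ∈ dom h, finPart h z - inner ℝ p z ≤ c →
      inner ℝ z v ≤ C := by
    intro v hv
    have hq : p + r • v ∈ dom (conjugate h) := hball (by
      simp [norm_smul, hv, abs_of_pos hr])
    obtain ⟨M, hM⟩ := (mem_dom_conjugate_iff hbot).1 hq
    refine ⟨(M + c) / r, fun z hz hzc => ?_⟩
    have h1 := hM z hz
    rw [inner_add_right, real_inner_smul_right, real_inner_comm] at h1
    rw [le_div_iff₀ hr]
    linarith
  have key2 : ∀ i : Fin d, ∃ C, ∀ z ∈ dom h, finPart h z - inner ℝ p z ≤ c → |z i| ≤ C := by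
    intro i
    obtain ⟨C₁, h₁⟩ := key (EuclideanSpace.single i 1) (by simp)
    obtain ⟨C₂, h₂⟩ := key (-EuclideanSpace.single i 1) (by simp)
    refine ⟨max C₁ C₂, fun z hz hzc => ?_⟩
    have a₁ := h₁ z hz hzc
    have a₂ := h₂ z hz hzc
    simp only [inner_neg_right, EuclideanSpace.inner_single_right, one_mul,
      conj_trivial] at a₁ a₂
    exact abs_le.2 ⟨by linarith [le_max_right C₁ C₂], a₁.trans (le_max_left _ _)⟩
  choose C hC using key2
  refine ⟨√(∑ i, C i ^ 2), fun z hz hzc => ?_⟩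
  rw [EuclideanSpace.norm_eq]
  refine Real.sqrt_le_sqrt (Finset.sum_le_sum fun i _ => ?_)
  rw [Real.norm_eq_abs]
  exact pow_le_pow_left₀ (abs_nonneg _) (hC i z hz hzc) 2

theorem IsProperClosedConvex.exists_isMinOn_sub_inner {h : 𝔼 → EReal}
    (hh : IsProperClosedConvex h) {p : 𝔼} (hp : p ∈ interior (dom (conjugate h))) :
    ∃ x ∈ dom h, ∀ z ∈ dom h, finPart h x - inner ℝ p x ≤ finPart h z - inner ℝ p z := by
  obtain ⟨y, hy⟩ := hh.dom_nonempty
  obtain ⟨R, hR⟩ := exists_norm_le_of_mem_interior_dom_conjugate hh.ne_bot hp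
    (finPart h y - inner ℝ p y)
  set H : 𝔼 → EReal := fun z => h z + ((-inner ℝ p z : ℝ) : EReal)
  have hlsc : LowerSemicontinuous H := by
    refine hh.closed.add' (Continuous.lowerSemicontinuous ?_) fun x => ?_
    · exact continuous_coe_real_ereal.comp (by fun_prop)
    · exact EReal.continuousAt_add (.inr (EReal.coe_ne_bot _)) (.inl (hh.ne_bot x))
  have hHcoe : ∀ z ∈ dom h, H z = ((finPart h z - inner ℝ p z : ℝ) : EReal) := by
    intro z hz
    simp only [H]
    rw [← coe_finPart hh.ne_bot hz, ← EReal.coe_add, sub_eq_add_neg]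
  have hyR : y ∈ Metric.closedBall (0 : 𝔼) R := by
    simpa using hR y hy le_rfl
  obtain ⟨x, -, hmin⟩ := (hlsc.lowerSemicontinuousOn _).exists_isMinOn ⟨y, hyR⟩
    (isCompact_closedBall (0 : 𝔼) R)
  have hxy : H x ≤ H y := hmin hyR
  have hx : x ∈ dom h := by
    rw [hHcoe y hy] at hxy
    have h1 : H x < ⊤ := hxy.trans_lt (EReal.coe_lt_top _)
    by_contra hx
    have : h x = ⊤ := by simpa [dom] using hx
    simp [H, this] at h1
  refine ⟨x, hx, fun z hz => ?_⟩
  rw [hHcoe x hx, hHcoe y hy, EReal.coe_le_coe_iff] at hxy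
  rcases le_total (finPart h z - inner ℝ p z) (finPart h y - inner ℝ p y) with hzy | hzy
  · have h1 : H x ≤ H z := hmin (by simpa using hR z hz hzy)
    rwa [hHcoe x hx, hHcoe z hz, EReal.coe_le_coe_iff] at h1
  · exact hxy.trans hzy

theorem IsEssentiallySmooth.exists_grad_eq {f : 𝔼 → EReal} (hf : IsEssentiallySmooth f) {p : 𝔼}
    (hp : p ∈ interior (dom (conjugate f))) : ∃ x ∈ interior (dom f), grad f x = p := by
  obtain ⟨x, hx, hmin⟩ := hf.exists_isMinOn_sub_inner hp
  have hxi := hf.mem_interior_of_isMinOn hx hmin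
  refine ⟨x, hxi, ?_⟩
  have hloc : IsLocalMin (fun z => finPart f z - inner ℝ p z) x := by
    filter_upwards [mem_interior_iff_mem_nhds.1 hxi] with z hz using hmin z hz
  have hder : HasFDerivAt (fun z => finPart f z - inner ℝ p z)
      (InnerProductSpace.toDual ℝ 𝔼 (grad f x) - InnerProductSpace.toDual ℝ 𝔼 p) x :=
    (hf.hasGradientAt hxi).hasFDerivAt.sub (InnerProductSpace.toDual ℝ 𝔼 p).hasFDerivAt
  exact (InnerProductSpace.toDual ℝ 𝔼).injective (sub_eq_zero.1 (hloc.hasFDerivAt_eq_zero hder))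

theorem IsLegendre.image_grad {f : 𝔼 → EReal} (hf : IsLegendre f) :
    grad f '' interior (dom f) = interior (dom (conjugate f)) :=
  Subset.antisymm (image_subset_iff.2 fun _ hx => hf.grad_mem_interior_dom_conjugate hx)
    fun _ hp => hf.exists_grad_eq hp

/-! ### The gradient of the conjugate -/

/-- Equality in the Fenchel-Young inequality at a gradient. -/
theorem IsLegendre.finPart_conjugate_grad {f : 𝔼 → EReal} (hf : IsLegendre f) {x : 𝔼}
    (hx : x ∈ interior (dom f)) :
    finPart (conjugate f) (grad f x) = inner ℝ x (grad f x) - finPart f x := by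
  have hp := interior_subset (hf.grad_mem_interior_dom_conjugate hx)
  refine le_antisymm ?_ (inner_sub_finPart_le hf.ne_bot hp (interior_subset hx))
  rw [← EReal.coe_le_coe_iff, coe_finPart (conjugate_ne_bot hf.toIsProperClosedConvex) hp,
    conjugate_le_coe_iff hf.ne_bot]
  intro z hz
  have := hf.add_inner_grad_le hx hz
  rw [inner_sub_right, real_inner_comm, real_inner_comm x] at this
  linarith

/-- The gradient of the conjugate inverts the gradient. The difference quotient of the conjugate at
`grad f x` is squeezed between `x` and the maximizers for nearby slopes, which converge to `x` by
the linear growth of the Bregman divergence. -/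
theorem IsLegendre.hasGradientAt_conjugate {f : 𝔼 → EReal} (hf : IsLegendre f) {x : 𝔼}
    (hx : x ∈ interior (dom f)) :
    HasGradientAt (finPart (conjugate f)) x (grad f x) := by
  have hp := hf.grad_mem_interior_dom_conjugate hx
  rw [hasGradientAt_iff_isLittleO, Asymptotics.isLittleO_iff]
  intro r hr
  obtain ⟨η, hη, hgrow⟩ := hf.exists_linear_growth hx hr
  filter_upwards [isOpen_interior.mem_nhds hp, Metric.ball_mem_nhds _ hη] with q hq hqη
  rw [mem_ball_iff_norm] at hqη
  obtain ⟨y, hy, rfl⟩ := hf.exists_grad_eq hq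
  have hxy : ‖y - x‖ ≤ r := by
    by_contra! hlt
    have h1 := hgrow y (interior_subset hy) hlt.le
    have h2 := hf.add_inner_grad_le hy (interior_subset hx)
    have h3 : inner ℝ (grad f y - grad f x) (y - x) < η * ‖y - x‖ :=
      (real_inner_le_norm _ _).trans_lt (mul_lt_mul_of_pos_right hqη (hr.trans hlt))
    rw [← neg_sub y x, inner_neg_right] at h2
    rw [inner_sub_left] at h3
    linarith
  have hlow := inner_sub_finPart_le hf.ne_bot (interior_subset hq) (interior_subset hx)
  have hupp := inner_sub_finPart_le hf.ne_bot (interior_subset hp) (interior_subset hy)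
  rw [hf.finPart_conjugate_grad hx] at hupp ⊢
  rw [hf.finPart_conjugate_grad hy] at hlow ⊢
  have h4 : inner ℝ (y - x) (grad f y - grad f x) ≤ r * ‖grad f y - grad f x‖ :=
    (real_inner_le_norm _ _).trans (mul_le_mul_of_nonneg_right hxy (norm_nonneg _))
  simp only [inner_sub_left, inner_sub_right] at h4 ⊢
  rw [Real.norm_eq_abs, abs_le]
  constructor
  · have : 0 ≤ r * ‖grad f y - grad f x‖ := by positivity
    linarith
  · linarith

/-! ### Relative smoothness and strong convexity through Bregman divergences -/

/-- Since `D_{f*}(∇f(y), ∇f(x)) = D_f(x, y)`, convexity of a combination of `k` and `f*` is an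
inequality between the Bregman divergences of `k` and `f`. -/
theorem IsLegendre.convexOn_add_conjugate_iff {f k : 𝔼 → EReal} (hf : IsLegendre f)
    (hk : IsEssentiallySmooth k)
    (hsub : interior (dom (conjugate f)) ⊆ interior (dom k)) (a b : ℝ) :
    ConvexOn ℝ (interior (dom (conjugate f)))
        (fun p => a * finPart k p + b * finPart (conjugate f) p) ↔
      ∀ x ∈ interior (dom f), ∀ y ∈ interior (dom f),
        0 ≤ a * realBregman k (grad f y) (grad f x) + b * realBregman f x y := by
  have hV := (convex_dom_conjugate hf.ne_bot).interior
  have hgr : ∀ p ∈ interior (dom (conjugate f)),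
      HasGradientAt (fun p => a * finPart k p + b * finPart (conjugate f) p)
        (a • grad k p + b • grad (conjugate f) p) p := by
    intro p hp
    have h1 := (hk.hasGradientAt (hsub hp)).hasFDerivAt.const_mul a
    have h2 : HasGradientAt (finPart (conjugate f)) (grad (conjugate f) p) p := by
      obtain ⟨x, hx, rfl⟩ := hf.exists_grad_eq hp
      exact (hf.hasGradientAt_conjugate hx).differentiableAt.hasGradientAt
    rw [hasGradientAt_iff_hasFDerivAt]
    rw [map_add, map_smul, map_smul]
    exact h1.add (h2.hasFDerivAt.const_mul b)
  rw [convexOn_iff_forall_add_inner_le hV hgr, ← hf.image_grad, forall_mem_image]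
  refine forall₂_congr fun x hx => ?_
  rw [forall_mem_image]
  refine forall₂_congr fun y hy => ?_
  have hgx : grad (conjugate f) (grad f x) = x := (hf.hasGradientAt_conjugate hx).gradient
  rw [hgx, hf.finPart_conjugate_grad hx, hf.finPart_conjugate_grad hy, ← sub_nonneg]
  simp only [realBregman, inner_add_left, real_inner_smul_left, inner_sub_right]
  rw [real_inner_comm (grad f y) x, real_inner_comm (grad f y) y]
  ring_nf

theorem IsLegendre.subset_dom_inter_iff {f k : 𝔼 → EReal} (hf : IsLegendre f) :
    interior (dom (conjugate f)) ⊆ dom k ∩ dom (conjugate f) ↔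
      grad f '' interior (dom f) ⊆ interior (dom k) := by
  rw [hf.image_grad, subset_inter_iff, isOpen_interior.subset_interior_iff,
    and_iff_left interior_subset]

theorem IsLegendre.relSmoothOn_conjugate_iff {f k : 𝔼 → EReal} (hf : IsLegendre f)
    (hk : IsEssentiallySmooth k) (L : ℝ) :
    RelSmoothOn k (conjugate f) (interior (dom (conjugate f))) L ↔
      grad f '' interior (dom f) ⊆ interior (dom k) ∧
      ∀ x ∈ interior (dom f), ∀ y ∈ interior (dom f),
        bregman k (grad f y) (grad f x) ≤ (L : EReal) * bregman f x y := by
  rw [RelSmoothOn, and_iff_right (convex_dom_conjugate hf.ne_bot).interior,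
    hf.subset_dom_inter_iff]
  refine and_congr_right fun hsub => ?_
  rw [convexFun_iff_convexOn (s := interior (dom (conjugate f)))
    (F := fun p => (-1) * finPart k p + L * finPart (conjugate f) p),
    hf.convexOn_add_conjugate_iff hk (hf.image_grad ▸ hsub)]
  · refine forall₄_congr fun x hx y hy => ?_
    rw [hk.bregman_eq (interior_subset (hsub (mem_image_of_mem _ hy)))
      (hsub (mem_image_of_mem _ hx)), hf.bregman_eq (interior_subset hx) hy, ← EReal.coe_mul,
      EReal.coe_le_coe_iff]
    constructor <;> intro h <;> linarith
  · intro p hp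
    have hpk : p ∈ dom k := interior_subset (hsub (hf.image_grad ▸ hp))
    rw [smoothGap, if_pos hp, ← coe_finPart hk.ne_bot hpk,
      ← coe_finPart (conjugate_ne_bot hf.toIsProperClosedConvex) (interior_subset hp),
      ← EReal.coe_mul, ← EReal.coe_sub]
    ring_nf
  · intro p hp
    rw [smoothGap, if_neg hp]

theorem IsLegendre.relStronglyConvexOn_conjugate_iff {f k : 𝔼 → EReal} (hf : IsLegendre f)
    (hk : IsEssentiallySmooth k) (μ : ℝ) :
    RelStronglyConvexOn k (conjugate f) (interior (dom (conjugate f))) μ ↔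
      grad f '' interior (dom f) ⊆ interior (dom k) ∧
      ∀ x ∈ interior (dom f), ∀ y ∈ interior (dom f),
        (μ : EReal) * bregman f x y ≤ bregman k (grad f y) (grad f x) := by
  rw [RelStronglyConvexOn, and_iff_right (convex_dom_conjugate hf.ne_bot).interior,
    hf.subset_dom_inter_iff]
  refine and_congr_right fun hsub => ?_
  rw [convexFun_iff_convexOn (s := interior (dom (conjugate f)))
    (F := fun p => 1 * finPart k p + (-μ) * finPart (conjugate f) p),
    hf.convexOn_add_conjugate_iff hk (hf.image_grad ▸ hsub)]
  · refine forall₄_congr fun x hx y hy => ?_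
    rw [hk.bregman_eq (interior_subset (hsub (mem_image_of_mem _ hy)))
      (hsub (mem_image_of_mem _ hx)), hf.bregman_eq (interior_subset hx) hy, ← EReal.coe_mul,
      EReal.coe_le_coe_iff]
    constructor <;> intro h <;> linarith
  · intro p hp
    have hpk : p ∈ dom k := interior_subset (hsub (hf.image_grad ▸ hp))
    rw [strongGap, if_pos hp, ← coe_finPart hk.ne_bot hpk,
      ← coe_finPart (conjugate_ne_bot hf.toIsProperClosedConvex) (interior_subset hp),
      ← EReal.coe_mul, ← EReal.coe_sub]
    ring_nf
  · intro p hp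
    rw [strongGap, if_neg hp]

end DualPrecond

theorem mainTheorem2 {d : ℕ} (f k : EuclideanSpace ℝ (Fin d) → EReal)
    (hf : DualPrecond.IsLegendre f) (hk : DualPrecond.IsLegendre k)
    (L μ : ℝ) (hL : 0 ≤ L) (hμ : 0 ≤ μ) :
    (DualPrecond.RelSmoothOn k (DualPrecond.conjugate f)
        (interior (DualPrecond.dom (DualPrecond.conjugate f))) L ↔
      DualPrecond.grad f '' interior (DualPrecond.dom f) ⊆ interior (DualPrecond.dom k) ∧
      ∀ x ∈ interior (DualPrecond.dom f), ∀ y ∈ interior (DualPrecond.dom f),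
        DualPrecond.bregman k (DualPrecond.grad f y) (DualPrecond.grad f x) ≤
          (L : EReal) * DualPrecond.bregman f x y) ∧
    (DualPrecond.RelStronglyConvexOn k (DualPrecond.conjugate f)
        (interior (DualPrecond.dom (DualPrecond.conjugate f))) μ ↔
      DualPrecond.grad f '' interior (DualPrecond.dom f) ⊆ interior (DualPrecond.dom k) ∧
      ∀ x ∈ interior (DualPrecond.dom f), ∀ y ∈ interior (DualPrecond.dom f),
        (μ : EReal) * DualPrecond.bregman f x y ≤
          DualPrecond.bregman k (DualPrecond.grad f y) (DualPrecond.grad f x)) := by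
  exact ⟨hf.relSmoothOn_conjugate_iff hk.toIsEssentiallySmooth L,
    hf.relStronglyConvexOn_conjugate_iff hk.toIsEssentiallySmooth μ⟩
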